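/- Let $\Lambda$ be a finite set of sites, let site $i$ carry the Hilbert space $\mathbb C^{q_i}$ with $q_i\ge 1$, and for $X\subseteq\Lambda$ let $\mathcal D_X=\prod_{i\in X}q_i$ be the dimension of the Hilbert space on $X$. Let $k\in\mathbb N$, $J_0\ge 0$, and let $$H=\sum_{Z\subseteq\Lambda,\ |Z|\le k}h_Z,\qquad \max_{i\in\Lambda}\sum_{Z\ni i}\|h_Z\|\le J_0,$$ be a $k$-local Hamiltonian, where each $h_Z$ is Hermitian and supported on $Z$ and $\|\cdot\|$ is the operator norm. For $\beta>0$ let $\rho_\beta=e^{\beta H}/\mathrm{tr}(e^{\beta H})$, and for $L\subseteq\Lambda$ with complement $L^{\rm c}=\Lambda\setminus L$ let $\rho_{\beta,L^{\rm c}}=\mathrm{tr}_L(\rho_\beta)$ and $H^*_{L^{\rm c}}=\frac1\beta\log\rho_{\beta,L^{\rm c}}$. (1) If $\bar J_0$ is a real number with $$3J_0|L^{\rm c}|+2J_0k\log(8\mathcal D_{L^{\rm c}})+1\le\bar J_0|L^{\rm c}|,$$ then $\rho_{\beta,L^{\rm c}}$ is positive definite, its minimum eigenvalue satisfies $$\lambda_{\min}(\rho_{\beta,L^{\rm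 c}})\ \ge\ \frac{e^{-\beta\bar J_0|L^{\rm c}|}}{16\,\mathcal D_{L^{\rm c}}\,\bar J_0\,|L^{\rm c}|},$$ and $$\|\beta H^*_{L^{\rm c}}\|\ \le\ \beta\bar J_0|L^{\rm c}|+\log\bigl(16\,\bar J_0\,|L^{\rm c}|\,\mathcal D_{L^{\rm c}}\bigr).$$ (2) The right-hand side of the last inequality is $O(\beta|L^{\rm c}|)$ for temperatures bounded above and bounded local dimension: for all $\bar J_0\in\mathbb R$, $d\in\mathbb N$ and $\beta_0>0$ there is a constant $C$, depending only on $J_0,k,\bar J_0,d,\beta_0$, such that it is at most $C\beta|L^{\rm c}|$ whenever $\beta\ge\beta_0$, $q_i\le d$ for all $i$, and $\bar J_0$ satisfies the inequality in (1). (3) Consequently $\|\beta H^*_{L^{\rm c}}\|=O(\beta|L^{\rm c}|)$: for all $d\in\mathbb N$ and $\beta_0>0$ there is a constant $C$, depending only on $J_0,k,d,\beta_0$, such that $\|\beta H^*_{L^{\rm c}}\|\le C\beta|L^{\rm c}|$ for all such systems with $q_i\le d$ for all $i$, all $L\subseteq\Lambda$ and all $\beta\ge\beta_0$. -/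

import Mathlib

open scoped Matrix.Norms.L2Operator ComplexOrder

universe u

noncomputable section

namespace QGibbs

variable {Λ : Type u} [Fintype Λ] [DecidableEq Λ]

/-- Labels of the product basis of the full Hilbert space `⨂ i, ℂ^(q i)`: one basis label of
`ℂ^(q i)` for every site `i`. Operators on the full space are complex matrices indexed by these. -/
abbrev Config (q : Λ → ℕ) : Type u := ∀ i : Λ, Fin (q i)

/-- Labels of the product basis of the Hilbert space of the subset `X` of sites. -/
abbrev SubConfig (q : Λ → ℕ) (X : Finset Λ) : Type u := ∀ i : X, Fin (q i)

/-- The dimension of the Hilbert space of the subset `X` of sites. -/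
def dimOn (q : Λ → ℕ) (X : Finset Λ) : ℕ := ∏ i ∈ X, q i

/-- The operator `B ⊗ 1` on the full space, for an operator `B` on the Hilbert space of `X`. -/
def extendOp (q : Λ → ℕ) (X : Finset Λ) (B : Matrix (SubConfig q X) (SubConfig q X) ℂ) :
    Matrix (Config q) (Config q) ℂ :=
  Matrix.of fun σ τ =>
    if ∀ i, i ∉ X → σ i = τ i then B (fun i => σ i) (fun i => τ i) else 0

/-- `A` acts nontrivially only on the sites in `X`. -/
def IsSupportedOn (q : Λ → ℕ) (X : Finset Λ) (A : Matrix (Config q) (Config q) ℂ) : Prop :=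
  ∃ B : Matrix (SubConfig q X) (SubConfig q X) ℂ, A = extendOp q X B

/-- A basis label on `L` and one on the complement of `L` together give one on all sites. -/
def glue (q : Λ → ℕ) (L : Finset Λ) (c : SubConfig q L) (a : SubConfig q Lᶜ) : Config q :=
  fun i => if h : i ∈ L then c ⟨i, h⟩ else a ⟨i, Finset.mem_compl.2 h⟩

/-- The partial trace over the sites in `L`; the result acts on the complement of `L`. -/
def partialTrace (q : Λ → ℕ) (L : Finset Λ) (A : Matrix (Config q) (Config q) ℂ) :
    Matrix (SubConfig q Lᶜ) (SubConfig q Lᶜ) ℂ :=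
  Matrix.of fun a b => ∑ c : SubConfig q L, A (glue q L c a) (glue q L c b)

/-- A family `h` of interaction terms, one for each set `Z` of sites, that is `k`-local and has
one-site energy at most `J₀`. Norms of matrices are operator norms. -/
structure IsKLocalInteraction (q : Λ → ℕ) (k : ℕ) (J₀ : ℝ)
    (h : Finset Λ → Matrix (Config q) (Config q) ℂ) : Prop where
  isHermitian : ∀ Z, (h Z).IsHermitian
  isSupportedOn : ∀ Z, IsSupportedOn q Z (h Z)
  eq_zero_of_card : ∀ Z, k < Z.card → h Z = 0
  oneSiteEnergy_le : ∀ i, ∑ Z : Finset Λ with i ∈ Z, ‖h Z‖ ≤ J₀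

/-- The Hamiltonian `H = ∑_Z h_Z`. -/
def hamiltonian (q : Λ → ℕ) (h : Finset Λ → Matrix (Config q) (Config q) ℂ) :
    Matrix (Config q) (Config q) ℂ :=
  ∑ Z : Finset Λ, h Z

/-- The Gibbs state `e^{β H} / tr (e^{β H})`; the sign convention is `e^{+β H}`. -/
def gibbsState (q : Λ → ℕ) (β : ℝ) (H : Matrix (Config q) (Config q) ℂ) :
    Matrix (Config q) (Config q) ℂ :=
  (Matrix.trace (NormedSpace.exp (β • H)))⁻¹ • NormedSpace.exp (β • H)

/-- The reduced Gibbs state on the complement of `L`. -/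
def reducedGibbs (q : Λ → ℕ) (β : ℝ) (H : Matrix (Config q) (Config q) ℂ) (L : Finset Λ) :
    Matrix (SubConfig q Lᶜ) (SubConfig q Lᶜ) ℂ :=
  partialTrace q L (gibbsState q β H)

/-- The effective (entanglement) Hamiltonian on the complement of `L`: `1/β` times the logarithm of
the reduced Gibbs state. -/
def effectiveHamiltonian (q : Λ → ℕ) (β : ℝ) (H : Matrix (Config q) (Config q) ℂ)
    (L : Finset Λ) : Matrix (SubConfig q Lᶜ) (SubConfig q Lᶜ) ℂ :=
  (1 / β) • CFC.log (reducedGibbs q β H L)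

/-- The inequality `3 J₀ |X| + 2 J₀ k log (8 D_X) + 1 ≤ J |X|` between the one-site energy `J₀` and
the constant `J`. -/
def IsAdmissibleConstant (q : Λ → ℕ) (k : ℕ) (J₀ J : ℝ) (X : Finset Λ) : Prop :=
  3 * J₀ * (X.card : ℝ) + (2 * J₀ * (k : ℝ)) * Real.log (8 * (dimOn q X : ℝ)) + 1
    ≤ J * (X.card : ℝ)

/-- The bound `β J |X| + log (16 J |X| D_X)`. -/
def normBound (q : Λ → ℕ) (β J : ℝ) (X : Finset Λ) : ℝ :=
  β * J * (X.card : ℝ) + Real.log (16 * J * (X.card : ℝ) * (dimOn q X : ℝ))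

end QGibbs

end

/-! Write X for the complement of `L`, D for its dimension, and c = β J₀ |X|. Removing every term of
H that touches X changes βH by at most c in norm and leaves B ⊗ 1, with B acting on `L`. For a unit
vector φ on X, the expectation of tr_L e^{βH} in φ is the trace of e^{βH} compressed by v ↦ v ⊗ φ.
Jensen's inequality in an eigenbasis of B bounds it below by e^{-c} tr e^B, while the same
inequality gives tr e^{βH} ≤ e^c D tr e^B. The quotient shows that the reduced state is at least
e^{-2c}/D (`traceLeft_exp_lower`, `le_expectation_reducedGibbs`).

Its trace is 1, so its spectrum lies in [e^{-2c}/D, 1] and its logarithm has norm at most 2c + log D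
(`norm_effectiveHamiltonian_le`). All three claims follow from this sharper bound: admissibility
gives J|X| ≥ 1 + 2J₀|X|, which absorbs it. -/

namespace QGibbs

/-! ### Convexity inequalities for the trace of an exponential -/

section TraceExponential

open Matrix
open scoped MatrixOrder

/-- The real part of the expectation value `⟨v, A v⟩`. -/
def expectation {n : Type*} [Fintype n] (A : Matrix n n ℂ) (v : n → ℂ) : ℝ :=
  (star v ⬝ᵥ A *ᵥ v).re

lemma expectation_add {n : Type*} [Fintype n] (A B : Matrix n n ℂ) (v : n → ℂ) :
    expectation (A + B) v = expectation A v + expectation B v := by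
  simp [expectation, add_mulVec, dotProduct_add]

lemma expectation_sub {n : Type*} [Fintype n] (A B : Matrix n n ℂ) (v : n → ℂ) :
    expectation (A - B) v = expectation A v - expectation B v := by
  simp [expectation, sub_mulVec, dotProduct_sub]

lemma expectation_smul {n : Type*} [Fintype n] (r : ℝ) (A : Matrix n n ℂ) (v : n → ℂ) :
    expectation (r • A) v = r * expectation A v := by
  simp [expectation, smul_mulVec, dotProduct_smul]

variable {m n : Type*} [Fintype m] [DecidableEq m] [Fintype n] [DecidableEq n]

/-- The tangent line inequality `e ^ t (1 + x - t) ≤ e ^ x` for Hermitian matrices. -/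
lemma tangent_le_exp {H : Matrix n n ℂ} (hH : H.IsHermitian) (t : ℝ) :
    Real.exp t • (H + (1 - t) • (1 : Matrix n n ℂ)) ≤ NormedSpace.exp H := by
  have hs : IsSelfAdjoint H := hH
  have h1 : cfc (fun x : ℝ => Real.exp t * (x + (1 - t))) H =
      Real.exp t • (H + (1 - t) • (1 : Matrix n n ℂ)) := by
    rw [cfc_const_mul .., cfc_add_const .., cfc_id' .., Algebra.algebraMap_eq_smul_one]
  rw [← h1, ← CFC.real_exp_eq_normedSpace_exp hs]
  refine cfc_mono fun x _ => ?_
  have h2 : Real.exp x = Real.exp t * Real.exp (x - t) := by rw [← Real.exp_add]; ring_nf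
  rw [h2]
  have := Real.add_one_le_exp (x - t)
  exact mul_le_mul_of_nonneg_left (by linarith) (Real.exp_pos t).le

/-- Jensen's inequality for the exponential in the state given by a unit vector. -/
lemma exp_expectation_le {H : Matrix n n ℂ} (hH : H.IsHermitian) {v : n → ℂ}
    (hv : star v ⬝ᵥ v = 1) :
    Real.exp (expectation H v) ≤ expectation (NormedSpace.exp H) v := by
  -- With the tangent taken at the mean of H, the linear term has zero expectation.
  have h := (Matrix.le_iff.1 (tangent_le_exp hH (expectation H v))).re_dotProduct_nonneg v
  change 0 ≤ expectation _ v at h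
  have h1 : expectation (1 : Matrix n n ℂ) v = 1 := by simp [expectation, hv]
  rw [expectation_sub, expectation_smul, expectation_add, expectation_smul, h1] at h
  linarith [mul_comm (Real.exp (expectation H v)) 1]

lemma expectation_eigenvector {A : Matrix m m ℂ} (hA : A.IsHermitian) (j : m) :
    expectation A (hA.eigenvectorBasis j).ofLp = hA.eigenvalues j :=
  (hA.eigenvalues_eq j).symm

lemma star_dotProduct_eigenvector {A : Matrix m m ℂ} (hA : A.IsHermitian) (j : m) :
    star (hA.eigenvectorBasis j).ofLp ⬝ᵥ (hA.eigenvectorBasis j).ofLp = 1 := by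
  have h := hA.eigenvectorBasis.orthonormal.1 j
  have h2 := inner_self_eq_norm_sq_to_K (𝕜 := ℂ) (hA.eigenvectorBasis j)
  rw [h, EuclideanSpace.inner_eq_star_dotProduct, dotProduct_comm] at h2
  simpa using h2

lemma trace_eq_sum_expectation {A : Matrix m m ℂ} (hA : A.IsHermitian) (M : Matrix m m ℂ) :
    M.trace.re = ∑ j, expectation M (hA.eigenvectorBasis j).ofLp := by
  have h : M.trace = (star (hA.eigenvectorUnitary : Matrix m m ℂ) * M *
      (hA.eigenvectorUnitary : Matrix m m ℂ)).trace := by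
    rw [trace_mul_cycle, Matrix.mem_unitaryGroup_iff.1 hA.eigenvectorUnitary.2, one_mul]
  rw [h, trace, Complex.re_sum]
  refine Finset.sum_congr rfl fun j _ => ?_
  simp only [expectation, diag_apply, mul_apply, dotProduct, mulVec, star_apply,
    IsHermitian.eigenvectorUnitary_apply, Finset.sum_mul, Finset.mul_sum, Pi.star_apply]
  rw [Finset.sum_comm]
  simp only [mul_assoc]

lemma trace_exp_eq {A : Matrix m m ℂ} (hA : A.IsHermitian) :
    (NormedSpace.exp A).trace.re = ∑ j, Real.exp (hA.eigenvalues j) := by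
  rw [← CFC.real_exp_eq_normedSpace_exp (a := A) hA, hA.cfc_eq, IsHermitian.cfc,
    Unitary.conjStarAlgAut_apply, trace_mul_cycle, Unitary.coe_star_mul_self, one_mul,
    trace_diagonal, Complex.re_sum]
  simp [Complex.exp_ofReal_re]

/-- Berezin--Lieb inequality for the compression of `H` by an isometry `V`. -/
lemma trace_exp_le_of_isometry {A : Matrix m m ℂ} {H : Matrix n n ℂ} (hA : A.IsHermitian)
    (hH : H.IsHermitian) {V : Matrix n m ℂ} (hV : Vᴴ * V = 1) {c : ℝ}
    (h : ∀ v : m → ℂ, star v ⬝ᵥ v = 1 → expectation A v - c ≤ expectation H (V *ᵥ v)) :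
    Real.exp (-c) * (NormedSpace.exp A).trace.re ≤ (Vᴴ * NormedSpace.exp H * V).trace.re := by
  -- Both traces are expanded in an eigenbasis of A, leaving Jensen for each vector V v_j.
  rw [trace_exp_eq hA, trace_eq_sum_expectation hA, Finset.mul_sum]
  refine Finset.sum_le_sum fun j _ => ?_
  have hv := star_dotProduct_eigenvector hA j
  have hVv : star (V *ᵥ (hA.eigenvectorBasis j).ofLp) ⬝ᵥ
      (V *ᵥ (hA.eigenvectorBasis j).ofLp) = 1 := by
    rw [star_mulVec, ← dotProduct_mulVec, mulVec_mulVec, hV, one_mulVec, hv]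
  have h1 := exp_expectation_le hH hVv
  have h2 := h _ hv
  rw [expectation_eigenvector] at h2
  rw [← Real.exp_add]
  refine (Real.exp_le_exp.2 (by linarith)).trans (h1.trans_eq ?_)
  simp only [expectation, star_mulVec, ← dotProduct_mulVec, ← mulVec_mulVec]

lemma trace_exp_pos [Nonempty m] {A : Matrix m m ℂ} (hA : A.IsHermitian) :
    0 < (NormedSpace.exp A).trace.re := by
  rw [trace_exp_eq hA]
  exact Finset.sum_pos (fun _ _ => Real.exp_pos _) Finset.univ_nonempty

lemma abs_expectation_le (A : Matrix n n ℂ) {v : n → ℂ} (hv : star v ⬝ᵥ v = 1) :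
    |expectation A v| ≤ ‖A‖ := by
  set x : EuclideanSpace ℂ n := WithLp.toLp 2 v
  have hx : ‖x‖ = 1 := by
    have h2 := inner_self_eq_norm_sq_to_K (𝕜 := ℂ) x
    rw [EuclideanSpace.inner_eq_star_dotProduct, dotProduct_comm, hv] at h2
    have h3 : ‖x‖ ^ 2 = 1 := Complex.ofReal_injective (by simpa using h2.symm)
    nlinarith [norm_nonneg x]
  have h1 : expectation A v = (inner ℂ x (WithLp.toLp 2 (A *ᵥ v))).re := by
    rw [EuclideanSpace.inner_eq_star_dotProduct, dotProduct_comm]; rfl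
  rw [h1]
  refine (Complex.abs_re_le_norm _).trans ((norm_inner_le_norm _ _).trans ?_)
  have := l2_opNorm_mulVec A x
  rw [hx, mul_one] at this
  rw [hx, one_mul]
  exact this

end TraceExponential

/-! ### Partial trace of an exponential close to e^{B ⊗ 1} -/

section Bipartite

open Matrix

variable {C X : Type*} [Fintype C] [DecidableEq C] [Fintype X]

/-- The isometry `v ↦ v ⊗ φ`. -/
def tensorVec (C : Type*) [DecidableEq C] (φ : X → ℂ) : Matrix (C × X) C ℂ :=
  Matrix.of fun p c => if p.1 = c then φ p.2 else 0

/-- The partial trace over the first factor. -/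
def traceLeft (M : Matrix (C × X) (C × X) ℂ) : Matrix X X ℂ :=
  Matrix.of fun a b => ∑ c, M (c, a) (c, b)

lemma tensorVec_isometry {φ : X → ℂ} (hφ : star φ ⬝ᵥ φ = 1) :
    (tensorVec C φ)ᴴ * tensorVec C φ = 1 := by
  ext c d
  simp only [mul_apply, conjTranspose_apply, tensorVec, of_apply, Fintype.sum_prod_type, one_apply]
  by_cases h : c = d
  · subst h
    simp only [dotProduct, Pi.star_apply] at hφ
    simpa [apply_ite] using hφ
  · rw [if_neg h]
    refine Finset.sum_eq_zero fun e _ => Finset.sum_eq_zero fun a _ => ?_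
    by_cases h1 : e = c
    · subst h1; simp [h]
    · simp [h1]

/-- This turns a lower bound on the partial trace into a bound on the trace of a compression, to
which Berezin–Lieb applies. -/
lemma trace_tensorVec (φ : X → ℂ) (M : Matrix (C × X) (C × X) ℂ) :
    ((tensorVec C φ)ᴴ * M * tensorVec C φ).trace = star φ ⬝ᵥ traceLeft M *ᵥ φ := by
  simp only [trace, diag_apply, mul_apply, conjTranspose_apply, tensorVec, of_apply,
    Fintype.sum_prod_type, dotProduct, mulVec, traceLeft, Pi.star_apply, Finset.mul_sum,
    Finset.sum_mul]
  simp only [apply_ite star, star_zero, ite_mul, zero_mul, mul_ite, mul_zero]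
  simp only [Finset.sum_ite_irrel, Finset.sum_const_zero, Finset.sum_ite_eq',
    Finset.mem_univ, if_true]
  rw [Finset.sum_comm]
  conv_rhs => rw [Finset.sum_comm]
  refine Finset.sum_congr rfl fun b _ => ?_
  rw [Finset.sum_comm]
  simp only [mul_assoc]

lemma blockDiagonal_mul_tensorVec [DecidableEq X] (φ : X → ℂ) (B : Matrix C C ℂ) :
    blockDiagonal (fun _ : X => B) * tensorVec C φ = tensorVec C φ * B := by
  ext ⟨c, a⟩ d
  simp [mul_apply, tensorVec, blockDiagonal_apply, Fintype.sum_prod_type, mul_comm]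

/-- Numerator and normalisation are each compared with tr e^B, at a cost of e^{-c} each; the
dimension of X enters through tr e^{B ⊗ 1}. -/
lemma traceLeft_exp_lower [DecidableEq X] {K : Matrix (C × X) (C × X) ℂ} {B : Matrix C C ℂ}
    (hK : K.IsHermitian) (hB : B.IsHermitian) {c : ℝ}
    (h : ∀ w, star w ⬝ᵥ w = 1 → |expectation (K - blockDiagonal fun _ : X => B) w| ≤ c)
    {φ : X → ℂ} (hφ : star φ ⬝ᵥ φ = 1) :
    Real.exp (-(2 * c)) * (NormedSpace.exp K).trace.re ≤
      Fintype.card X * expectation (traceLeft (NormedSpace.exp K)) φ := by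
  have hD : (blockDiagonal fun _ : X => B).IsHermitian := by
    rw [IsHermitian, blockDiagonal_conjTranspose]; simp only [hB.eq]
  have h1 : Real.exp (-c) * (NormedSpace.exp B).trace.re ≤
      expectation (traceLeft (NormedSpace.exp K)) φ := by
    rw [expectation, ← trace_tensorVec]
    refine trace_exp_le_of_isometry hB hK (tensorVec_isometry hφ) fun v hv => ?_
    have hVv : star (tensorVec C φ *ᵥ v) ⬝ᵥ (tensorVec C φ *ᵥ v) = 1 := by
      rw [star_mulVec, ← dotProduct_mulVec, mulVec_mulVec, tensorVec_isometry hφ, one_mulVec, hv]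
    have h2 := (abs_le.1 (h _ hVv)).1
    have h3 : expectation (blockDiagonal fun _ : X => B) (tensorVec C φ *ᵥ v) =
        expectation B v := by
      rw [expectation, mulVec_mulVec, blockDiagonal_mul_tensorVec, star_mulVec, ← dotProduct_mulVec,
        mulVec_mulVec, ← Matrix.mul_assoc, tensorVec_isometry hφ, Matrix.one_mul, expectation]
    rw [expectation_sub, h3] at h2
    linarith
  have h2 : Real.exp (-c) * (NormedSpace.exp K).trace.re ≤
      Fintype.card X * (NormedSpace.exp B).trace.re := by
    -- With V = 1 and the roles exchanged, Berezin–Lieb becomes monotonicity of the trace of the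
    -- exponential.
    have h3 := trace_exp_le_of_isometry (V := 1) (c := c) hK hD (by simp) (fun v hv => by
      have h2 := (abs_le.1 (h _ hv)).2
      rw [expectation_sub] at h2
      rw [one_mulVec]
      linarith)
    refine h3.trans_eq ?_
    rw [conjTranspose_one, one_mul, mul_one, exp_blockDiagonal, trace_blockDiagonal]
    let _ : NormedAlgebra ℚ (Matrix C C ℂ) := NormedAlgebra.restrictScalars ℚ ℂ _
    simp
  calc Real.exp (-(2 * c)) * (NormedSpace.exp K).trace.re
      = Real.exp (-c) * (Real.exp (-c) * (NormedSpace.exp K).trace.re) := by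
        rw [← mul_assoc, ← Real.exp_add]; ring_nf
    _ ≤ Real.exp (-c) * (Fintype.card X * (NormedSpace.exp B).trace.re) := by gcongr
    _ = Fintype.card X * (Real.exp (-c) * (NormedSpace.exp B).trace.re) := by ring
    _ ≤ _ := by gcongr

end Bipartite

/-! ### Total trace and relabelling of bases -/

section Bipartite

open Matrix

variable {C X : Type*} [Fintype C] [Fintype X]

lemma trace_traceLeft (M : Matrix (C × X) (C × X) ℂ) : (traceLeft M).trace = M.trace := by
  simp only [trace, diag_apply, traceLeft, of_apply, Fintype.sum_prod_type]
  exact Finset.sum_comm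

lemma exp_submatrix {m n : Type*} [Fintype m] [DecidableEq m] [Fintype n] [DecidableEq n]
    (e : m ≃ n) (A : Matrix n n ℂ) :
    NormedSpace.exp (A.submatrix e e) = (NormedSpace.exp A).submatrix e e := by
  let _ : NormedAlgebra ℚ (Matrix n n ℂ) := NormedAlgebra.restrictScalars ℚ ℂ _
  let _ : NormedAlgebra ℚ (Matrix m m ℂ) := NormedAlgebra.restrictScalars ℚ ℂ _
  exact (NormedSpace.map_exp (Matrix.reindexAlgEquiv ℂ ℂ e.symm)
    (continuous_id.matrix_submatrix e e) A).symm

lemma expectation_submatrix {m n : Type*} [Fintype m] [Fintype n]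
    (e : m ≃ n) (A : Matrix n n ℂ) (w : m → ℂ) :
    expectation (A.submatrix e e) w = expectation A (w ∘ e.symm) := by
  have h : star w = star (w ∘ e.symm) ∘ e := by ext; simp
  rw [expectation, submatrix_mulVec_equiv, h, comp_equiv_dotProduct_comp_equiv, expectation]

end Bipartite

/-! ### From the lattice to the bipartite setting -/

section Lattice

open Matrix

lemma card_subConfig {Λ : Type u} [DecidableEq Λ] {q : Λ → ℕ} (X : Finset Λ) :
    Fintype.card (SubConfig q X) = dimOn q X := by
  rw [Fintype.card_pi, dimOn, ← Finset.prod_coe_sort X q]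
  simp

variable {Λ : Type u} [Fintype Λ] [DecidableEq Λ] {q : Λ → ℕ}

/-- The basis of the full space as a product of the bases for `L` and for its complement. -/
def splitEquiv (q : Λ → ℕ) (L : Finset Λ) : SubConfig q L × SubConfig q Lᶜ ≃ Config q where
  toFun p := glue q L p.1 p.2
  invFun σ := (fun i => σ i, fun i => σ i)
  left_inv p := by
    refine Prod.ext ?_ ?_
    · ext i; simp [glue]
    · ext i; simp [glue, Finset.mem_compl.1 i.2]
  right_inv σ := by ext i; simp [glue]

lemma partialTrace_eq_traceLeft (L : Finset Λ) (A : Matrix (Config q) (Config q) ℂ) :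
    partialTrace q L A = traceLeft (A.submatrix (splitEquiv q L) (splitEquiv q L)) := rfl

/-- An operator supported inside `L` has the form B ⊗ 1; the reference label `a₀` only serves to
read off B. -/
lemma IsSupportedOn.apply_glue {Z L : Finset Λ} {A : Matrix (Config q) (Config q) ℂ}
    (hA : IsSupportedOn q Z A) (hZ : Z ⊆ L) (a₀ a b : SubConfig q Lᶜ) (c d : SubConfig q L) :
    A (glue q L c a) (glue q L d b) =
      if a = b then A (glue q L c a₀) (glue q L d a₀) else 0 := by
  obtain ⟨B, rfl⟩ := hA
  simp only [extendOp, of_apply]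
  by_cases hab : a = b
  · subst hab
    have h1 : ∀ a : SubConfig q Lᶜ, (∀ i, i ∉ Z → glue q L c a i = glue q L d a i) ↔
        ∀ i : L, i.1 ∉ Z → c i = d i := fun a => by
      refine ⟨fun h i hi => by simpa [glue] using h i hi, fun h i hi => ?_⟩
      by_cases hL : i ∈ L
      · simpa [glue, hL] using h ⟨i, hL⟩ hi
      · simp [glue, hL]
    have h2 : ∀ (c : SubConfig q L) (a : SubConfig q Lᶜ),
        (fun i : Z => glue q L c a i) = fun i : Z => c ⟨i, hZ i.2⟩ := fun c a => by
      ext i; simp [glue, hZ i.2]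
    simp only [h1, h2, if_true]
  · rw [if_neg hab, if_neg]
    refine fun h => hab (funext fun i => ?_)
    have hi := Finset.mem_compl.1 i.2
    simpa [glue, hi] using h i fun hz => hi (hZ hz)

/-- The part of the Hamiltonian that acts inside `L`. -/
def innerHamiltonian (L : Finset Λ) (h : Finset Λ → Matrix (Config q) (Config q) ℂ) :
    Matrix (Config q) (Config q) ℂ :=
  ∑ Z : Finset Λ with Z ⊆ L, h Z

variable {k : ℕ} {J₀ : ℝ} {h : Finset Λ → Matrix (Config q) (Config q) ℂ}

lemma isHermitian_sum {n ι : Type*} (s : Finset ι) (f : ι → Matrix n n ℂ)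
    (hf : ∀ i ∈ s, (f i).IsHermitian) : (∑ i ∈ s, f i).IsHermitian := by
  rw [IsHermitian, conjTranspose_sum]
  exact Finset.sum_congr rfl fun i hi => hf i hi

lemma IsKLocalInteraction.submatrix_innerHamiltonian (hh : IsKLocalInteraction q k J₀ h)
    (L : Finset Λ) (a₀ : SubConfig q Lᶜ) :
    (innerHamiltonian L h).submatrix (splitEquiv q L) (splitEquiv q L) =
      blockDiagonal fun _ => (innerHamiltonian L h).submatrix
        (fun c => glue q L c a₀) (fun c => glue q L c a₀) := by
  ext ⟨c, a⟩ ⟨d, b⟩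
  simp only [submatrix_apply, blockDiagonal_apply, splitEquiv, Equiv.coe_fn_mk, innerHamiltonian,
    Matrix.sum_apply]
  have h1 : ∀ Z ∈ Finset.univ.filter (· ⊆ L), h Z (glue q L c a) (glue q L d b) =
      if a = b then h Z (glue q L c a₀) (glue q L d a₀) else 0 := fun Z hZ =>
    (hh.isSupportedOn Z).apply_glue (Finset.mem_filter.1 hZ).2 a₀ a b c d
  rw [Finset.sum_congr rfl h1]
  split_ifs <;> simp

lemma IsKLocalInteraction.norm_sub_innerHamiltonian_le (hh : IsKLocalInteraction q k J₀ h)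
    (L : Finset Λ) :
    ‖hamiltonian q h - innerHamiltonian L h‖ ≤ J₀ * (Lᶜ.card : ℝ) := by
  have h1 : hamiltonian q h - innerHamiltonian L h = ∑ Z : Finset Λ with ¬ Z ⊆ L, h Z := by
    rw [hamiltonian, innerHamiltonian, sub_eq_iff_eq_add', Finset.sum_filter_add_sum_filter_not]
  rw [h1]
  calc ‖∑ Z : Finset Λ with ¬ Z ⊆ L, h Z‖ ≤ ∑ Z : Finset Λ with ¬ Z ⊆ L, ‖h Z‖ := norm_sum_le _ _
    _ = ∑ Z : Finset Λ, if ¬ Z ⊆ L then ‖h Z‖ else 0 := Finset.sum_filter _ _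
    -- A term not contained in `L` meets `Lᶜ`, so it is counted at one site there at least.
    _ ≤ ∑ Z : Finset Λ, ∑ i ∈ Lᶜ, if i ∈ Z then ‖h Z‖ else 0 := by
      refine Finset.sum_le_sum fun Z _ => ?_
      have h0 : ∀ i ∈ Lᶜ, 0 ≤ if i ∈ Z then ‖h Z‖ else 0 := fun i _ => by positivity
      by_cases hZ : Z ⊆ L
      · simpa [hZ] using Finset.sum_nonneg h0
      · obtain ⟨i, hi, hiL⟩ := Finset.not_subset.1 hZ
        have := Finset.single_le_sum h0 (Finset.mem_compl.2 hiL)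
        simpa [hi, hZ] using this
    _ = ∑ i ∈ Lᶜ, ∑ Z : Finset Λ with i ∈ Z, ‖h Z‖ := by
      rw [Finset.sum_comm]; simp only [Finset.sum_filter]
    _ ≤ ∑ i ∈ Lᶜ, J₀ := Finset.sum_le_sum fun i _ => hh.oneSiteEnergy_le i
    _ = J₀ * (Lᶜ.card : ℝ) := by simp [mul_comm]

lemma IsKLocalInteraction.isHermitian_hamiltonian (hh : IsKLocalInteraction q k J₀ h) :
    (hamiltonian q h).IsHermitian :=
  isHermitian_sum _ _ fun Z _ => hh.isHermitian Z

lemma isHermitian_real_smul {n : Type*} {A : Matrix n n ℂ} (hA : A.IsHermitian) (r : ℝ) :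
    (r • A).IsHermitian := by
  rw [IsHermitian, conjTranspose_smul, hA.eq, star_trivial]

/-- The partition function is real because the exponential is Hermitian; real scalars pass through
`expectation`. -/
lemma gibbsState_eq_real_smul {H : Matrix (Config q) (Config q) ℂ} (hH : H.IsHermitian) (β : ℝ) :
    gibbsState q β H =
      ((NormedSpace.exp (β • H)).trace.re)⁻¹ • NormedSpace.exp (β • H) := by
  have h1 := (isHermitian_real_smul hH β).exp
  have h2 : ((NormedSpace.exp (β • H)).trace.re : ℂ) = (NormedSpace.exp (β • H)).trace := by
    rw [← Complex.conj_eq_iff_re, starRingEnd_apply, ← trace_conjTranspose, h1.eq]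
  rw [gibbsState]
  conv_lhs => rw [← h2]
  ext
  simp

lemma isHermitian_reducedGibbs {H : Matrix (Config q) (Config q) ℂ} (hH : H.IsHermitian) (β : ℝ)
    (L : Finset Λ) : (reducedGibbs q β H L).IsHermitian := by
  have h1 : (gibbsState q β H).IsHermitian := by
    rw [gibbsState_eq_real_smul hH]
    exact isHermitian_real_smul (isHermitian_real_smul hH β).exp _
  ext a b
  simp only [reducedGibbs, partialTrace, conjTranspose_apply, of_apply, star_sum]
  exact Finset.sum_congr rfl fun c _ => h1.apply _ _

lemma trace_reducedGibbs [Nonempty (Config q)] {H : Matrix (Config q) (Config q) ℂ}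
    (hH : H.IsHermitian) (β : ℝ) (L : Finset Λ) : (reducedGibbs q β H L).trace = 1 := by
  have h1 := trace_exp_pos (isHermitian_real_smul hH β)
  have h2 : (NormedSpace.exp (β • H)).trace ≠ 0 := fun h => by simp [h] at h1
  rw [reducedGibbs, partialTrace_eq_traceLeft, trace_traceLeft, gibbsState]
  have h3 : ∀ M : Matrix (Config q) (Config q) ℂ,
      (M.submatrix (splitEquiv q L) (splitEquiv q L)).trace = M.trace := fun M =>
    Equiv.sum_comp (splitEquiv q L) fun σ => M σ σ
  rw [h3, trace_smul, smul_eq_mul, inv_mul_cancel₀ h2]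

lemma IsKLocalInteraction.le_expectation_reducedGibbs [Nonempty (Config q)]
    (hh : IsKLocalInteraction q k J₀ h) (L : Finset Λ) {β : ℝ} (hβ : 0 < β)
    {φ : SubConfig q Lᶜ → ℂ} (hφ : star φ ⬝ᵥ φ = 1) :
    Real.exp (-(2 * (β * (J₀ * (Lᶜ.card : ℝ))))) ≤
      dimOn q Lᶜ * expectation (reducedGibbs q β (hamiltonian q h) L) φ := by
  have σ₀ : Config q := Classical.arbitrary _
  set H := hamiltonian q h
  have hH : H.IsHermitian := hh.isHermitian_hamiltonian
  set e := splitEquiv q L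
  set a₀ : SubConfig q Lᶜ := fun i => σ₀ i
  set B := (innerHamiltonian L h).submatrix (fun c => glue q L c a₀) (fun c => glue q L c a₀)
  have hB : B.IsHermitian :=
    (isHermitian_sum _ _ fun Z _ => hh.isHermitian Z :
      (innerHamiltonian L h).IsHermitian).submatrix _
  have hβH := isHermitian_real_smul hH β
  have hdiff : (β • H).submatrix e e - (blockDiagonal fun _ : SubConfig q Lᶜ => β • B) =
      (β • (H - innerHamiltonian L h)).submatrix e e := by
    have h1 := hh.submatrix_innerHamiltonian L a₀
    have h2 : (blockDiagonal fun _ : SubConfig q Lᶜ => β • B) =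
        β • (blockDiagonal fun _ : SubConfig q Lᶜ => B) := blockDiagonal_smul β _
    rw [h2, ← h1, smul_sub]
    rfl
  have key := traceLeft_exp_lower (hβH.submatrix e) (isHermitian_real_smul hB β)
    (c := β * (J₀ * (Lᶜ.card : ℝ))) (fun w hw => by
      rw [hdiff, expectation_submatrix, expectation_smul, abs_mul, abs_of_pos hβ]
      refine mul_le_mul_of_nonneg_left ?_ hβ.le
      refine (abs_expectation_le _ ?_).trans (hh.norm_sub_innerHamiltonian_le L)
      have h1 : star (w ∘ e.symm) = star w ∘ e.symm := rfl
      rw [h1, comp_equiv_dotProduct_comp_equiv, hw]) hφ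
  have htr : ((NormedSpace.exp (β • H)).submatrix e e).trace = (NormedSpace.exp (β • H)).trace :=
    Equiv.sum_comp e fun σ => NormedSpace.exp (β • H) σ σ
  rw [exp_submatrix, htr, card_subConfig] at key
  have hpos := trace_exp_pos hβH
  have hred : expectation (reducedGibbs q β H L) φ = ((NormedSpace.exp (β • H)).trace.re)⁻¹ *
      expectation (traceLeft ((NormedSpace.exp (β • H)).submatrix e e)) φ := by
    rw [← expectation_smul, reducedGibbs, gibbsState_eq_real_smul hH, partialTrace_eq_traceLeft]
    congr 1
    ext a b
    simp [traceLeft, Finset.mul_sum, e]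
  rw [hred, mul_left_comm (dimOn q Lᶜ : ℝ), ← div_eq_inv_mul, le_div_iff₀ hpos]
  exact key

end Lattice

/-! ### Spectral bounds and absorption into the constants -/

section Spectrum

open Matrix

section Dimension

variable {Λ : Type u} {q : Λ → ℕ}

lemma one_le_dimOn (hq : ∀ i, 1 ≤ q i) (X : Finset Λ) : (1 : ℝ) ≤ dimOn q X := by
  exact_mod_cast Finset.one_le_prod' fun i _ => hq i

lemma log_dimOn_le {d : ℕ} (hq : ∀ i, 1 ≤ q i ∧ q i ≤ d) (X : Finset Λ) :
    Real.log (dimOn q X) ≤ d * (X.card : ℝ) := by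
  rw [dimOn, Nat.cast_prod, Real.log_prod fun i _ => by
    have := (hq i).1
    positivity]
  calc ∑ i ∈ X, Real.log (q i) ≤ ∑ _i ∈ X, (d : ℝ) := Finset.sum_le_sum fun i _ =>
        (Real.log_le_self (Nat.cast_nonneg _)).trans (by exact_mod_cast (hq i).2)
    _ = d * (X.card : ℝ) := by simp [mul_comm]

lemma exp_div_dimOn_pos (hq : ∀ i, 1 ≤ q i) (X : Finset Λ) (t : ℝ) :
    0 < Real.exp t / dimOn q X :=
  div_pos (Real.exp_pos _) (by linarith [one_le_dimOn hq X])

/-- All that is needed from admissibility: the summand 1 makes the logarithm's argument positive,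
and 2J₀|X| matches the exponent 2c. -/
lemma IsAdmissibleConstant.one_add_le {k : ℕ} {J₀ J : ℝ} {X : Finset Λ} (hJ₀ : 0 ≤ J₀) (hq : ∀ i, 1 ≤ q i)
    (hJ : IsAdmissibleConstant q k J₀ J X) : 1 + 2 * (J₀ * (X.card : ℝ)) ≤ J * (X.card : ℝ) := by
  have h1 : 0 ≤ 2 * J₀ * (k : ℝ) * Real.log (8 * (dimOn q X : ℝ)) :=
    mul_nonneg (by positivity) (Real.log_nonneg (by linarith [one_le_dimOn hq X]))
  have h2 : 0 ≤ J₀ * (X.card : ℝ) := by positivity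
  have h3 := hJ
  rw [IsAdmissibleConstant] at h3
  linarith

lemma normBound_le {k : ℕ} {J₀ J β₀ β : ℝ} {d : ℕ} {X : Finset Λ} (hJ₀ : 0 ≤ J₀)
    (hq : ∀ i, 1 ≤ q i ∧ q i ≤ d) (hβ₀ : 0 < β₀) (hβ : β₀ ≤ β)
    (hJ : IsAdmissibleConstant q k J₀ J X) :
    normBound q β J X ≤ (J + (16 * |J| + d) / β₀) * (β * (X.card : ℝ)) := by
  have h1 := hJ.one_add_le hJ₀ fun i => (hq i).1
  have h2 : 0 ≤ J₀ * (X.card : ℝ) := by positivity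
  have hJX : 0 < J * (X.card : ℝ) := by linarith
  have hD := one_le_dimOn (fun i => (hq i).1) X
  -- The crude bound log x ≤ x suffices; |J| keeps the constant nonnegative for every J.
  have h3 : Real.log (16 * J * (X.card : ℝ) * dimOn q X) ≤ (16 * |J| + d) * (X.card : ℝ) := by
    rw [Real.log_mul (by rw [mul_assoc]; positivity) (by positivity), add_mul]
    refine add_le_add ((Real.log_le_self (by rw [mul_assoc]; positivity)).trans ?_)
      (log_dimOn_le hq X)
    gcongr
    exact le_abs_self J
  have h4 : (16 * |J| + d) * (X.card : ℝ) ≤ (16 * |J| + d) / β₀ * (β * (X.card : ℝ)) := by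
    rw [div_mul_eq_mul_div, le_div_iff₀ hβ₀]
    calc (16 * |J| + d) * (X.card : ℝ) * β₀ ≤ (16 * |J| + d) * (X.card : ℝ) * β := by gcongr
      _ = _ := by ring
  rw [normBound]
  linarith

end Dimension

variable {Λ : Type u} [Fintype Λ] [DecidableEq Λ] {q : Λ → ℕ} {k : ℕ} {J₀ : ℝ}
  {h : Finset Λ → Matrix (Config q) (Config q) ℂ}

lemma IsKLocalInteraction.le_eigenvalues (hq : ∀ i, 1 ≤ q i) (hh : IsKLocalInteraction q k J₀ h)
    (L : Finset Λ) {β : ℝ} (hβ : 0 < β) (j : SubConfig q Lᶜ) :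
    Real.exp (-(2 * (β * (J₀ * (Lᶜ.card : ℝ))))) / dimOn q Lᶜ ≤
      (isHermitian_reducedGibbs hh.isHermitian_hamiltonian β L).eigenvalues j := by
  have : Nonempty (Config q) := ⟨fun i => ⟨0, hq i⟩⟩
  set hρ := isHermitian_reducedGibbs hh.isHermitian_hamiltonian β L
  have h1 := hh.le_expectation_reducedGibbs L hβ (star_dotProduct_eigenvector hρ j)
  rw [expectation_eigenvector] at h1
  rwa [div_le_iff₀' (by linarith [one_le_dimOn hq Lᶜ])]

lemma IsKLocalInteraction.le_of_mem_spectrum (hq : ∀ i, 1 ≤ q i)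
    (hh : IsKLocalInteraction q k J₀ h) (L : Finset Λ) {β : ℝ} (hβ : 0 < β) {μ : ℝ}
    (hμ : μ ∈ spectrum ℝ (reducedGibbs q β (hamiltonian q h) L)) :
    Real.exp (-(2 * (β * (J₀ * (Lᶜ.card : ℝ))))) / dimOn q Lᶜ ≤ μ := by
  rw [(isHermitian_reducedGibbs hh.isHermitian_hamiltonian β L).spectrum_real_eq_range_eigenvalues]
    at hμ
  obtain ⟨j, rfl⟩ := hμ
  exact hh.le_eigenvalues hq L hβ j

lemma IsKLocalInteraction.posDef_reducedGibbs (hq : ∀ i, 1 ≤ q i)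
    (hh : IsKLocalInteraction q k J₀ h) (L : Finset Λ) {β : ℝ} (hβ : 0 < β) :
    (reducedGibbs q β (hamiltonian q h) L).PosDef :=
  (isHermitian_reducedGibbs hh.isHermitian_hamiltonian β L).posDef_iff_eigenvalues_pos.2 fun j =>
    (exp_div_dimOn_pos hq _ _).trans_le (hh.le_eigenvalues hq L hβ j)

/-- The eigenvalues are positive and sum to the trace, which is 1. -/
lemma IsKLocalInteraction.le_one_of_mem_spectrum (hq : ∀ i, 1 ≤ q i)
    (hh : IsKLocalInteraction q k J₀ h) (L : Finset Λ) {β : ℝ} (hβ : 0 < β) {μ : ℝ}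
    (hμ : μ ∈ spectrum ℝ (reducedGibbs q β (hamiltonian q h) L)) : μ ≤ 1 := by
  have : Nonempty (Config q) := ⟨fun i => ⟨0, hq i⟩⟩
  have hρ := isHermitian_reducedGibbs hh.isHermitian_hamiltonian β L
  have htr := trace_reducedGibbs hh.isHermitian_hamiltonian β L
  rw [hρ.trace_eq_sum_eigenvalues] at htr
  have htr' : ∑ i, hρ.eigenvalues i = 1 := Complex.ofReal_injective (by simpa using htr)
  rw [hρ.spectrum_real_eq_range_eigenvalues] at hμ
  obtain ⟨j, rfl⟩ := hμ
  rw [← htr']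
  exact Finset.single_le_sum
    (fun i _ => ((hh.posDef_reducedGibbs hq L hβ).eigenvalues_pos i).le) (Finset.mem_univ j)

lemma IsKLocalInteraction.norm_effectiveHamiltonian_le (hJ₀ : 0 ≤ J₀) (hq : ∀ i, 1 ≤ q i)
    (hh : IsKLocalInteraction q k J₀ h) (L : Finset Λ) {β : ℝ} (hβ : 0 < β) :
    ‖β • effectiveHamiltonian q β (hamiltonian q h) L‖ ≤
      2 * (β * (J₀ * (Lᶜ.card : ℝ))) + Real.log (dimOn q Lᶜ) := by
  have hD := one_le_dimOn hq Lᶜ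
  rw [effectiveHamiltonian, smul_smul, mul_one_div_cancel hβ.ne', one_smul, CFC.log]
  refine norm_cfc_le (add_nonneg (by positivity) (Real.log_nonneg hD)) fun μ hμ => ?_
  have h1 := hh.le_of_mem_spectrum hq L hβ hμ
  have h2 := hh.le_one_of_mem_spectrum hq L hβ hμ
  have h0 := exp_div_dimOn_pos hq Lᶜ (-(2 * (β * (J₀ * (Lᶜ.card : ℝ)))))
  have h3 := Real.log_le_log h0 h1
  rw [Real.log_div (Real.exp_pos _).ne' (by positivity), Real.log_exp] at h3
  -- The spectrum lies below 1, so the logarithm is nonpositive and only the lower spectral bound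
  -- matters.
  rw [Real.norm_eq_abs, abs_of_nonpos (Real.log_nonpos (h0.le.trans h1) h2)]
  linarith

end Spectrum

end QGibbs

theorem mainTheorem11 (J₀ : ℝ) (hJ₀ : 0 ≤ J₀) (k : ℕ) :
    -- the explicit bounds
    (∀ (Λ : Type u) [Fintype Λ] [DecidableEq Λ] (q : Λ → ℕ), (∀ i, 1 ≤ q i) →
      ∀ h : Finset Λ → Matrix (QGibbs.Config q) (QGibbs.Config q) ℂ,
      QGibbs.IsKLocalInteraction q k J₀ h →
      ∀ (L : Finset Λ) (β J : ℝ), 0 < β → QGibbs.IsAdmissibleConstant q k J₀ J Lᶜ →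
        (QGibbs.reducedGibbs q β (QGibbs.hamiltonian q h) L).PosDef ∧
        (∀ μ ∈ spectrum ℝ (QGibbs.reducedGibbs q β (QGibbs.hamiltonian q h) L),
          Real.exp (-(β * J * (Lᶜ.card : ℝ))) /
            (16 * (QGibbs.dimOn q Lᶜ : ℝ) * J * (Lᶜ.card : ℝ)) ≤ μ) ∧
        ‖β • QGibbs.effectiveHamiltonian q β (QGibbs.hamiltonian q h) L‖
          ≤ QGibbs.normBound q β J Lᶜ) ∧
    -- the explicit bound is `O(β |Lᶜ|)`, for every fixed value of the constant `J`
    (∀ (J : ℝ) (d : ℕ) (β₀ : ℝ), 0 < β₀ → ∃ C : ℝ,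
      ∀ (Λ : Type u) [Fintype Λ] [DecidableEq Λ] (q : Λ → ℕ), (∀ i, 1 ≤ q i ∧ q i ≤ d) →
      ∀ (L : Finset Λ) (β : ℝ), β₀ ≤ β → QGibbs.IsAdmissibleConstant q k J₀ J Lᶜ →
        QGibbs.normBound q β J Lᶜ ≤ C * (β * (Lᶜ.card : ℝ))) ∧
    -- the norm is `O(β |Lᶜ|)`, with a constant that depends only on `J₀`, `k`, `d` and `β₀`
    (∀ (d : ℕ) (β₀ : ℝ), 0 < β₀ → ∃ C : ℝ,
      ∀ (Λ : Type u) [Fintype Λ] [DecidableEq Λ] (q : Λ → ℕ), (∀ i, 1 ≤ q i ∧ q i ≤ d) →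
      ∀ h : Finset Λ → Matrix (QGibbs.Config q) (QGibbs.Config q) ℂ,
      QGibbs.IsKLocalInteraction q k J₀ h →
      ∀ (L : Finset Λ) (β : ℝ), β₀ ≤ β →
        ‖β • QGibbs.effectiveHamiltonian q β (QGibbs.hamiltonian q h) L‖
          ≤ C * (β * (Lᶜ.card : ℝ))) := by
  refine ⟨fun Λ _ _ q hq h hh L β J hβ hJ => ⟨hh.posDef_reducedGibbs hq L hβ, fun μ hμ => ?_, ?_⟩,
    fun J d β₀ hβ₀ => ⟨J + (16 * |J| + d) / β₀, fun Λ _ _ q hq L β hβ hJ =>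
      QGibbs.normBound_le hJ₀ hq hβ₀ hβ hJ⟩,
    fun d β₀ hβ₀ => ⟨2 * J₀ + d / β₀, fun Λ _ _ q hq h hh L β hβ => ?_⟩⟩
  · refine le_trans ?_ (hh.le_of_mem_spectrum hq L hβ hμ)
    have h1 := hJ.one_add_le hJ₀ hq
    have h2 : 0 ≤ J₀ * (Lᶜ.card : ℝ) := by positivity
    have hD := QGibbs.one_le_dimOn hq Lᶜ
    -- The exponent uses 2J₀|X| ≤ J|X|, the denominator 16 J|X| ≥ 1.
    refine div_le_div₀ (Real.exp_pos _).le (Real.exp_le_exp.2 ?_) (by linarith) ?_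
    · nlinarith
    · nlinarith
  · refine (hh.norm_effectiveHamiltonian_le hJ₀ hq L hβ).trans ?_
    have h1 := hJ.one_add_le hJ₀ hq
    have h2 : 0 ≤ J₀ * (Lᶜ.card : ℝ) := by positivity
    have hD := QGibbs.one_le_dimOn hq Lᶜ
    refine add_le_add (by nlinarith) (Real.log_le_log (by linarith) ?_)
    nlinarith
  -- The sharper bound contains no J, so no admissible constant has to be chosen and an empty `Lᶜ`
  -- is covered.
  · refine (hh.norm_effectiveHamiltonian_le hJ₀ (fun i => (hq i).1) L (hβ₀.trans_le hβ)).trans ?_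
    have h1 := QGibbs.log_dimOn_le hq Lᶜ
    have h2 : (d : ℝ) * (Lᶜ.card : ℝ) ≤ d / β₀ * (β * (Lᶜ.card : ℝ)) := by
      rw [div_mul_eq_mul_div, le_div_iff₀ hβ₀]
      calc (d : ℝ) * (Lᶜ.card : ℝ) * β₀ ≤ d * (Lᶜ.card : ℝ) * β := by gcongr
        _ = _ := by ring
    linarith
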